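/- Let $a<b$ and $c<d$ be real numbers and let $K:[a,b]\times[c,d]\to\mathbb{R}$ be a continuous kernel of uniform bounded variation, i.e., there is a constant $V<\infty$ such that for every $y\in[c,d]$ the function $x\mapsto K(x,y)$ has total variation less than $V$ on $[a,b]$, and for every $x\in[a,b]$ the function $y\mapsto K(x,y)$ has total variation less than $V$ on $[c,d]$. Let $\sigma_1\ge\sigma_2\ge\cdots$ be the singular values of $K$ in non-increasing order, counted with multiplicity; that is, the numbers $\sigma_n>0$ for which there are functions $u_n$, orthonormal in $L^2([a,b])$, and $v_n$, orthonormal in $L^2([c,d])$, with $$\sigma_n u_n(x)=\int_c^d K(x,y)\,v_n(y)\,dy,\qquad \sigma_n v_n(y)=\int_a^b K(x,y)\,u_n(x)\,dx,$$ so that $\sigma_n$ is the largest $s>0$ for which there are $n$ such singular values (with orthonormal systems $u_1,\dots,u_n$ and $v_1,\dots,v_n$) that are all at least $s$, and $\sigma_n=0$ if $K$ has fewer than $n$ positive singular values. Then $$\sigma_n=\mathcal{O}(n^{-1})\qquad\text{as } n\to\infty .$$ -/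

import Mathlib

open MeasureTheory Set

/-- `K` is of uniform bounded variation on `[a,b] × [c,d]`: a single finite constant `V` bounds the
total variation of every slice `x ↦ K x y` on `[a,b]` and of every slice `y ↦ K x y` on `[c,d]`.
For a continuous slice, the total variation is the total mass of its weak derivative, that is, the
integral of the absolute value of the derivative when the slice is continuously differentiable. -/
def UniformBoundedVariation (a b c d : ℝ) (K : ℝ → ℝ → ℝ) : Prop :=
  ∃ V : ℝ,
    (∀ y ∈ Icc c d, eVariationOn (fun x => K x y) (Icc a b) < ENNReal.ofReal V) ∧
    (∀ x ∈ Icc a b, eVariationOn (fun y => K x y) (Icc c d) < ENNReal.ofReal V)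

/-- The finite family `f` consists of real functions that are orthonormal in `L²([p,q])`. -/
structure OrthonormalOnIcc (p q : ℝ) {n : ℕ} (f : Fin n → ℝ → ℝ) : Prop where
  memLp : ∀ i, MemLp (f i) 2 (volume.restrict (Icc p q))
  integral_mul : ∀ i j, ∫ t in Icc p q, f i t * f j t = if i = j then 1 else 0

/-- `σ 0, …, σ (n-1)` are positive singular values of the kernel `K` on `[a,b] × [c,d]`, listed with
at most their multiplicity: they come with singular functions `u i`, orthonormal in `L²([a,b])`, and
`v i`, orthonormal in `L²([c,d])`, such that
`σ i * u i x = ∫_c^d K x y * v i y dy` and `σ i * v i y = ∫_a^b K x y * u i x dx`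
(as elements of `L²`, that is, almost everywhere). -/
structure IsSingularSystem (a b c d : ℝ) (K : ℝ → ℝ → ℝ) {n : ℕ}
    (σ : Fin n → ℝ) (u v : Fin n → ℝ → ℝ) : Prop where
  pos : ∀ i, 0 < σ i
  orthonormal_u : OrthonormalOnIcc a b u
  orthonormal_v : OrthonormalOnIcc c d v
  eq_u : ∀ i, ∀ᵐ x ∂(volume.restrict (Icc a b)),
    σ i * u i x = ∫ y in Icc c d, K x y * v i y
  eq_v : ∀ i, ∀ᵐ y ∂(volume.restrict (Icc c d)),
    σ i * v i y = ∫ x in Icc a b, K x y * u i x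

/-- The `n`-th singular value `σ_n` (`n = 1, 2, …`) of the kernel `K` on `[a,b] × [c,d]`, in
non-increasing order and counted with multiplicity: the largest `s` for which `K` has `n` singular
values (with multiplicity) that are all at least `s`. It is `0` if `K` has fewer than `n` positive
singular values. The value at the index `n = 0` is not meaningful. -/
noncomputable def singularValue (a b c d : ℝ) (K : ℝ → ℝ → ℝ) (n : ℕ) : ℝ :=
  sSup {s : ℝ | ∃ (σ : Fin n → ℝ) (u v : Fin n → ℝ → ℝ),
    IsSingularSystem a b c d K σ u v ∧ ∀ i, s ≤ σ i}

/-! Cut `[a,b]` into `m` cells of length `h = (b-a)/m` and replace each slice `K(·,y)` by its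
left-endpoint values on the cells. This is a kernel of rank at most `m`. Bounded variation makes the
squared `L²` error at most `V² h` for every `y` (`norm_sq_sub_step_le`), hence at most `V² h (d-c)`
after integration over `y`. If `n` singular values are at least `s`, any approximation of rank `m`
leaves squared error at least `(n-m) s²` (`card_mul_sq_le_of_approx_in_span`). With `m` about `n/2`
this gives `s² = O(n⁻²)`. -/

/-- Courant–Fischer with Bessel: at least `n - m` orthonormal vectors in the span of `U` are
orthogonal to every `e j`. They do not see the approximant, so Bessel bounds their total energy by
`B`, while each carries energy at least `s²` after integration. -/
theorem card_mul_sq_le_of_approx_in_span {H Y : Type*} [NormedAddCommGroup H]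
    [InnerProductSpace ℝ H] [MeasurableSpace Y] {μ : Measure Y} [IsFiniteMeasure μ] {n m : ℕ}
    {U : Fin n → H} (hU : Orthonormal ℝ U) {v : Fin n → Y → ℝ} (hv : ∀ i, MemLp (v i) 2 μ)
    (hvv : ∀ i j, ∫ y, v i y * v j y ∂μ = if i = j then 1 else 0)
    {σ : Fin n → ℝ} {s : ℝ} (hs : 0 ≤ s) (hσ : ∀ i, s ≤ σ i) {κ : Y → H}
    (hκ : ∀ i, ∀ᵐ y ∂μ, σ i * v i y = inner ℝ (κ y) (U i))
    (e : Fin m → H) (τ : Y → Fin m → ℝ) {B : ℝ}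
    (hB : ∀ᵐ y ∂μ, ‖κ y - ∑ j, τ y j • e j‖ ^ 2 ≤ B) :
    ((n : ℝ) - m) * s ^ 2 ≤ B * μ.real univ := by
  set S : Submodule ℝ H := Submodule.span ℝ (range U) with hS
  have : FiniteDimensional ℝ S := FiniteDimensional.span_of_finite ℝ (finite_range U)
  let φ : S →ₗ[ℝ] (Fin m → ℝ) := LinearMap.pi fun j => (innerₛₗ ℝ (e j)).comp S.subtype
  let N := LinearMap.ker φ
  have hrank : n ≤ m + Module.finrank ℝ N := by
    have h1 := φ.finrank_range_add_finrank_ker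
    have h2 : Module.finrank ℝ (LinearMap.range φ) ≤ m := by
      simpa using Submodule.finrank_le (LinearMap.range φ)
    have h3 : Module.finrank ℝ S = n := by
      simpa using finrank_span_eq_card hU.linearIndependent
    change n ≤ m + Module.finrank ℝ (LinearMap.ker φ)
    omega
  let b := stdOrthonormalBasis ℝ N
  let W : Fin (Module.finrank ℝ N) → H := fun k => ((b k : S) : H)
  have hW : Orthonormal ℝ W :=
    (b.orthonormal.comp_linearIsometry N.subtypeₗᵢ).comp_linearIsometry S.subtypeₗᵢ
  have hWe : ∀ k j, inner ℝ (e j) (W k) = 0 := fun k j =>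
    congrFun (LinearMap.mem_ker.1 (b k).2) j
  have hWS : ∀ k, ∃ c : Fin n → ℝ, ∑ i, c i • U i = W k := fun k =>
    (Submodule.mem_span_range_iff_exists_fun ℝ).1 (b k : S).2
  choose c hc using hWS
  have hcn : ∀ k, ∑ i, c k i ^ 2 = 1 := by
    intro k
    have h1 : inner ℝ (W k) (W k) = (1 : ℝ) := by
      rw [real_inner_self_eq_norm_sq, hW.1 k, one_pow]
    rw [← hc k, hU.inner_sum] at h1
    simpa [sq] using h1
  have hpt : ∀ᵐ y ∂μ, ∑ k, (∑ i, c k i * (σ i * v i y)) ^ 2 ≤ B := by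
    filter_upwards [ae_all_iff.2 hκ, hB] with y hy hBy
    refine le_trans ?_ hBy
    have hbes := hW.sum_inner_products_le (x := κ y - ∑ j, τ y j • e j) (s := Finset.univ)
    refine le_trans (le_of_eq (Finset.sum_congr rfl fun k _ => ?_)) hbes
    -- The approximant drops out since `W k` is orthogonal to every `e j`.
    have : inner ℝ (W k) (κ y - ∑ j, τ y j • e j) = ∑ i, c k i * (σ i * v i y) := by
      rw [real_inner_comm, inner_sub_left, sum_inner]
      simp only [real_inner_smul_left, hWe, mul_zero, Finset.sum_const_zero, sub_zero]
      rw [← hc k, inner_sum]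
      exact Finset.sum_congr rfl fun i _ => by rw [real_inner_smul_right, hy i]
    rw [this, Real.norm_eq_abs, sq_abs]
  have hvint : ∀ i j, Integrable (fun y => v i y * v j y) μ := fun i j =>
    (hv i).integrable_mul (hv j)
  have hexp : ∀ k y, (∑ i, c k i * (σ i * v i y)) ^ 2 =
      ∑ i, ∑ j, (c k i * σ i * (c k j * σ j)) * (v i y * v j y) := by
    intro k y
    rw [sq, Finset.sum_mul_sum]
    exact Finset.sum_congr rfl fun i _ => Finset.sum_congr rfl fun j _ => by ring
  have hint : ∀ k, Integrable (fun y => (∑ i, c k i * (σ i * v i y)) ^ 2) μ := by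
    intro k
    simp_rw [hexp]
    exact integrable_finsetSum _ fun i _ => integrable_finsetSum _ fun j _ =>
      (hvint i j).const_mul _
  -- Orthonormality of `v` turns the integral into `∑ i, c k i ^ 2 * σ i ^ 2`, and the weights `c k
  -- i ^ 2` sum to `1`.
  have hval : ∀ k, s ^ 2 ≤ ∫ y, (∑ i, c k i * (σ i * v i y)) ^ 2 ∂μ := by
    intro k
    simp_rw [hexp]
    rw [integral_finsetSum _ fun i _ => integrable_finsetSum _ fun j _ =>
      (hvint i j).const_mul _]
    have : ∀ i, ∫ y, ∑ j, (c k i * σ i * (c k j * σ j)) * (v i y * v j y) ∂μ =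
        c k i ^ 2 * σ i ^ 2 := by
      intro i
      rw [integral_finsetSum _ fun j _ => (hvint i j).const_mul _]
      simp only [integral_const_mul, hvv, mul_ite, mul_one, mul_zero, Finset.sum_ite_eq,
        Finset.mem_univ, if_true]
      ring
    rw [Finset.sum_congr rfl fun i _ => this i]
    calc s ^ 2 = ∑ i, c k i ^ 2 * s ^ 2 := by rw [← Finset.sum_mul, hcn, one_mul]
      _ ≤ _ := Finset.sum_le_sum fun i _ => by
        gcongr
        exact hσ i
  have hr : ((n : ℝ) - m) ≤ Module.finrank ℝ N := by
    have : (n : ℝ) ≤ m + Module.finrank ℝ N := by exact_mod_cast hrank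
    linarith
  calc ((n : ℝ) - m) * s ^ 2 ≤ Module.finrank ℝ N * s ^ 2 := by gcongr
    _ = ∑ _k : Fin (Module.finrank ℝ N), s ^ 2 := by simp
    _ ≤ ∑ k, ∫ y, (∑ i, c k i * (σ i * v i y)) ^ 2 ∂μ := Finset.sum_le_sum fun k _ => hval k
    _ = ∫ y, ∑ k, (∑ i, c k i * (σ i * v i y)) ^ 2 ∂μ :=
      (integral_finsetSum _ fun k _ => hint k).symm
    _ ≤ ∫ _y, B ∂μ := integral_mono_ae (integrable_finsetSum _ fun k _ => hint k)
        (integrable_const B) hpt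
    _ = B * μ.real univ := by simp [mul_comm]

/-- The `j`-th of the cells of length `h` into which `(a, ∞)` is cut. -/
def uniformCell (a h : ℝ) (j : ℕ) : Set ℝ := Ioc (a + j * h) (a + (j + 1 : ℕ) * h)

theorem exists_mem_uniformCell {a b h : ℝ} {m : ℕ} (hh : 0 < h) (hb : a + m * h = b) {x : ℝ}
    (hx : x ∈ Ioc a b) : ∃ j : Fin m, x ∈ uniformCell a h j := by
  have h0 : 0 < (x - a) / h := div_pos (sub_pos.2 hx.1) hh
  have hpos : 0 < ⌈(x - a) / h⌉₊ := Nat.ceil_pos.2 h0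
  have hle : ⌈(x - a) / h⌉₊ ≤ m := by
    rw [Nat.ceil_le, div_le_iff₀ hh]
    linarith [hx.2]
  obtain ⟨k, hk⟩ : ∃ k, ⌈(x - a) / h⌉₊ = k + 1 := ⟨_, (Nat.succ_pred_eq_of_pos hpos).symm⟩
  refine ⟨⟨k, by omega⟩, ?_, ?_⟩
  · have : (k : ℝ) < (x - a) / h := Nat.lt_ceil.1 (by omega)
    rw [lt_div_iff₀ hh] at this
    change a + (k : ℝ) * h < x
    linarith
  · have := Nat.le_ceil ((x - a) / h)
    rw [hk, div_le_iff₀ hh] at this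
    change x ≤ a + ((k + 1 : ℕ) : ℝ) * h
    linarith

theorem eq_of_mem_uniformCell {a h : ℝ} (hh : 0 < h) {i j : ℕ} {x : ℝ}
    (hi : x ∈ uniformCell a h i) (hj : x ∈ uniformCell a h j) : i = j := by
  have key : ∀ {i j : ℕ}, x ∈ uniformCell a h i → x ∈ uniformCell a h j → i ≤ j := by
    intro i j hi hj
    have h1 : (i : ℝ) * h < (j + 1 : ℕ) * h := by linarith [hi.1, hj.2]
    have h2 : i < j + 1 := by exact_mod_cast lt_of_mul_lt_mul_right h1 hh.le
    omega
  exact le_antisymm (key hi hj) (key hj hi)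

/-- Variation is additive over adjacent cells, and a sum of squares of nonnegative numbers is at
most the square of their sum. -/
theorem sum_sq_variation_uniform_le {f : ℝ → ℝ} {a b h V : ℝ} {m : ℕ} (hh : 0 < h)
    (hb : a + m * h = b) (hV : eVariationOn f (Icc a b) < ENNReal.ofReal V) :
    ∑ j : Fin m, (eVariationOn f (Icc (a + (j : ℕ) * h) (a + ((j : ℕ) + 1 : ℕ) * h))).toReal ^ 2
      ≤ V ^ 2 := by
  have hmono : Monotone fun j : ℕ => a + (j : ℝ) * h := by
    intro i j hij
    have : (i : ℝ) ≤ j := by exact_mod_cast hij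
    dsimp only
    gcongr
  have hsum := eVariationOn.sum' f hmono (n := m)
  simp only [Nat.cast_zero, zero_mul, add_zero, hb] at hsum
  have hV0 : 0 ≤ V := by
    by_contra hneg
    rw [ENNReal.ofReal_of_nonpos (not_le.1 hneg).le] at hV
    exact not_lt_zero hV
  rw [Fin.sum_univ_eq_sum_range
    (fun j : ℕ => (eVariationOn f (Icc (a + j * h) (a + (j + 1 : ℕ) * h))).toReal ^ 2)]
  refine (Finset.sum_sq_le_sq_sum_of_nonneg fun _ _ => ENNReal.toReal_nonneg).trans ?_
  gcongr
  rw [← ENNReal.toReal_sum, hsum]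
  · exact (ENNReal.toReal_mono ENNReal.ofReal_ne_top hV.le).trans_eq (ENNReal.toReal_ofReal hV0)
  · intro j hj htop
    exact (hV.trans ENNReal.ofReal_lt_top).ne
      (hsum ▸ ENNReal.sum_eq_top.2 ⟨j, hj, htop⟩)

theorem Lp_norm_sq_eq_integral_sq {α : Type*} [MeasurableSpace α] {μ : Measure α} (g : Lp ℝ 2 μ) :
    ‖g‖ ^ 2 = ∫ x, g x ^ 2 ∂μ := by
  rw [← real_inner_self_eq_norm_sq, L2.inner_def]
  simp [sq]

/-- The indicator of a cell, as an element of `L²([a,b])`. -/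
noncomputable def cellIndicator (a b h : ℝ) (j : ℕ) : Lp ℝ 2 (volume.restrict (Icc a b)) :=
  indicatorConstLp 2 (s := uniformCell a h j) measurableSet_Ioc (measure_ne_top _ _) 1

/-- On a cell, `f` differs from its left-endpoint value by at most its variation `D j` there, so the
squared error is at most `h * ∑ j, D j ^ 2`. -/
theorem norm_sq_sub_step_le {f : ℝ → ℝ} {a b h V : ℝ} {m : ℕ} (hh : 0 < h)
    (hb : a + m * h = b) (hV : eVariationOn f (Icc a b) < ENNReal.ofReal V)
    (hf : MemLp f 2 (volume.restrict (Icc a b))) :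
    ‖hf.toLp f - ∑ j : Fin m, f (a + (j : ℕ) * h) • cellIndicator a b h j‖ ^ 2 ≤ V ^ 2 * h := by
  set D : ℕ → ℝ := fun j =>
    (eVariationOn f (Icc (a + j * h) (a + (j + 1 : ℕ) * h))).toReal with hD
  have hcoe : ⇑(hf.toLp f - ∑ j : Fin m, f (a + (j : ℕ) * h) • cellIndicator a b h j)
      =ᵐ[volume.restrict (Icc a b)] fun x => f x -
        ∑ j : Fin m, f (a + (j : ℕ) * h) * (uniformCell a h j).indicator (fun _ => (1 : ℝ)) x := by
    have hs := Lp.coeFn_finsetSum Finset.univ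
      (fun j : Fin m => f (a + (j : ℕ) * h) • cellIndicator a b h j)
    have hj : ∀ j : Fin m, ∀ᵐ x ∂(volume.restrict (Icc a b)),
        (f (a + (j : ℕ) * h) • cellIndicator a b h j : Lp ℝ 2 _) x =
        f (a + (j : ℕ) * h) * (uniformCell a h j).indicator (fun _ => (1 : ℝ)) x := by
      intro j
      filter_upwards [Lp.coeFn_smul (f (a + (j : ℕ) * h)) (cellIndicator a b h j),
        indicatorConstLp_coeFn (p := 2) (μ := volume.restrict (Icc a b))
          (s := uniformCell a h j) (hs := measurableSet_Ioc)
          (hμs := measure_ne_top _ _) (c := (1 : ℝ))] with x h1 h2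
      rw [h1, Pi.smul_apply, smul_eq_mul, cellIndicator, h2]
    filter_upwards [Lp.coeFn_sub (hf.toLp f)
      (∑ j : Fin m, f (a + (j : ℕ) * h) • cellIndicator a b h j), hf.coeFn_toLp, hs,
      ae_all_iff.2 hj] with x h1 h2 h3 h4
    rw [h1, Pi.sub_apply, h2, h3, Finset.sum_apply]
    exact congrArg _ (Finset.sum_congr rfl fun j _ => h4 j)
  -- The half-open cells miss the point `a`, a null set.
  have hIoc : ∀ᵐ x ∂(volume.restrict (Icc a b)), x ∈ Ioc a b := by
    rw [← restrict_Ioc_eq_restrict_Icc]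
    exact ae_restrict_mem measurableSet_Ioc
  have hbound : ∀ᵐ x ∂(volume.restrict (Icc a b)),
      (hf.toLp f - ∑ j : Fin m, f (a + (j : ℕ) * h) • cellIndicator a b h j :
        Lp ℝ 2 (volume.restrict (Icc a b))) x ^ 2 ≤
      ∑ j : Fin m, (uniformCell a h j).indicator (fun _ => D j ^ 2) x := by
    filter_upwards [hcoe, hIoc] with x hx hxI
    obtain ⟨k, hk⟩ := exists_mem_uniformCell hh hb hxI
    have hne : ∀ j : Fin m, j ≠ k → x ∉ uniformCell a h j := fun j hjk hj =>
      hjk (Fin.ext (eq_of_mem_uniformCell hh hj hk))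
    rw [hx, Finset.sum_eq_single k (fun j _ hjk => by rw [indicator_of_notMem (hne j hjk), mul_zero])
      (by simp), Finset.sum_eq_single k (fun j _ hjk => indicator_of_notMem (hne j hjk) _)
      (by simp), indicator_of_mem hk, indicator_of_mem hk, mul_one]
    have hbv : BoundedVariationOn f
        (Icc (a + (k : ℕ) * h) (a + ((k : ℕ) + 1 : ℕ) * h)) := by
      refine ne_top_of_le_ne_top (hV.trans ENNReal.ofReal_lt_top).ne
        (eVariationOn.mono f (Icc_subset_Icc ?_ ?_))
      · have : 0 ≤ ((k : ℕ) : ℝ) * h := by positivity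
        linarith
      · rw [← hb]
        have : (((k : ℕ) + 1 : ℕ) : ℝ) ≤ m := by exact_mod_cast k.2
        gcongr
    have hd := hbv.dist_le (x := x) (y := a + (k : ℕ) * h) ⟨hk.1.le, hk.2⟩
      ⟨le_rfl, hk.1.le.trans hk.2⟩
    rw [Real.dist_eq] at hd
    rw [← sq_abs (f x - _)]
    gcongr
  have hmeas : ∀ j, MeasurableSet (uniformCell a h j) := fun j => measurableSet_Ioc
  have hint : ∀ j : Fin m, Integrable ((uniformCell a h j).indicator fun _ => D j ^ 2)
      (volume.restrict (Icc a b)) := fun j => (integrable_const _).indicator (hmeas j)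
  rw [Lp_norm_sq_eq_integral_sq]
  calc _ ≤ ∫ x in Icc a b, ∑ j : Fin m, (uniformCell a h j).indicator (fun _ => D j ^ 2) x :=
        integral_mono_ae (Lp.memLp _).integrable_sq (integrable_finsetSum _ fun j _ => hint j)
          hbound
    _ = ∑ j : Fin m, (volume.restrict (Icc a b)).real (uniformCell a h j) * D j ^ 2 := by
        rw [integral_finsetSum _ fun j _ => hint j]
        exact Finset.sum_congr rfl fun j _ => by rw [integral_indicator_const _ (hmeas j)]; rfl
    _ ≤ ∑ j : Fin m, h * D j ^ 2 := by
        refine Finset.sum_le_sum fun j _ => mul_le_mul_of_nonneg_right ?_ (sq_nonneg _)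
        calc (volume.restrict (Icc a b)).real (uniformCell a h j)
            ≤ volume.real (uniformCell a h j) :=
              ENNReal.toReal_mono measure_Ioc_lt_top.ne (Measure.restrict_apply_le _ _)
          _ = h := by
              rw [uniformCell, Real.volume_real_Ioc_of_le (by push_cast; nlinarith)]
              push_cast
              ring
    _ = (∑ j : Fin m, D j ^ 2) * h := by rw [← Finset.mul_sum, mul_comm]
    _ ≤ V ^ 2 * h := mul_le_mul_of_nonneg_right (sum_sq_variation_uniform_le hh hb hV) hh.le

theorem OrthonormalOnIcc.orthonormal_toLp {p q : ℝ} {n : ℕ} {f : Fin n → ℝ → ℝ}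
    (hf : OrthonormalOnIcc p q f) : Orthonormal ℝ fun i => (hf.memLp i).toLp (f i) := by
  rw [orthonormal_iff_ite]
  intro i j
  rw [← hf.integral_mul i j, L2.inner_def]
  refine integral_congr_ae ?_
  filter_upwards [(hf.memLp i).coeFn_toLp, (hf.memLp j).coeFn_toLp] with x hi hj
  rw [hi, hj]
  simp [mul_comm]

theorem IsSingularSystem.sq_mul_sq_le {a b c d : ℝ} (hab : a < b) (hcd : c < d) {K : ℝ → ℝ → ℝ}
    (hK : ContinuousOn (fun p : ℝ × ℝ => K p.1 p.2) (Icc a b ×ˢ Icc c d)) {V : ℝ}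
    (hV : ∀ y ∈ Icc c d, eVariationOn (fun x => K x y) (Icc a b) < ENNReal.ofReal V)
    {n : ℕ} (hn : 2 ≤ n) {σ : Fin n → ℝ} {u v : Fin n → ℝ → ℝ}
    (h : IsSingularSystem a b c d K σ u v) {s : ℝ} (hs : 0 ≤ s) (hσ : ∀ i, s ≤ σ i) :
    s ^ 2 * (n : ℝ) ^ 2 ≤ 6 * (V ^ 2 * (b - a) * (d - c)) := by
  classical
  have hLp : ∀ y ∈ Icc c d, MemLp (fun x => K x y) 2 (volume.restrict (Icc a b)) := by
    intro y hy
    have hcont : ContinuousOn (fun x => K x y) (Icc a b) :=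
      hK.comp (f := fun x => (x, y)) (by fun_prop) fun x hx => ⟨hx, hy⟩
    obtain ⟨C, hC⟩ := isCompact_Icc.exists_bound_of_continuousOn hcont
    exact MemLp.of_bound (hcont.aestronglyMeasurable measurableSet_Icc) C
      ((ae_restrict_iff' measurableSet_Icc).2 (Filter.Eventually.of_forall hC))
  let κ : ℝ → Lp ℝ 2 (volume.restrict (Icc a b)) := fun y =>
    if hy : y ∈ Icc c d then (hLp y hy).toLp _ else 0
  have hmem : ∀ᵐ y ∂(volume.restrict (Icc c d)), y ∈ Icc c d := ae_restrict_mem measurableSet_Icc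
  -- For `n ≥ 2`, this `m` is positive with `n ≤ 3 * m` and `n ≤ 2 * (n - m)`; the product of these
  -- bounds gives the constant `6`.
  obtain ⟨m, hm⟩ : ∃ m, m = n / 2 := ⟨_, rfl⟩
  have hm0 : (0 : ℝ) < m := by exact_mod_cast (by omega : 0 < m)
  have hstep : 0 < (b - a) / m := div_pos (sub_pos.2 hab) hm0
  have key := card_mul_sq_le_of_approx_in_span (μ := volume.restrict (Icc c d))
    h.orthonormal_u.orthonormal_toLp h.orthonormal_v.memLp h.orthonormal_v.integral_mul hs hσ
    (κ := κ) (fun i => by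
      filter_upwards [h.eq_v i, hmem] with y hy hyI
      rw [hy, L2.inner_def]
      refine integral_congr_ae ?_
      simp only [κ, dif_pos hyI]
      filter_upwards [(hLp y hyI).coeFn_toLp, (h.orthonormal_u.memLp i).coeFn_toLp] with x h1 h2
      rw [h1, h2]
      simp [mul_comm])
    (fun j : Fin m => cellIndicator a b ((b - a) / m) j)
    (fun y j => K (a + (j : ℕ) * ((b - a) / m)) y) (B := V ^ 2 * ((b - a) / m)) (by
      filter_upwards [hmem] with y hyI
      simp only [κ, dif_pos hyI]
      exact norm_sq_sub_step_le hstep (by field_simp; ring) (hV y hyI) (hLp y hyI))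
  rw [measureReal_restrict_apply_univ, Real.volume_real_Icc_of_le hcd.le] at key
  have h1 : (n : ℝ) ≤ 3 * m := by exact_mod_cast (by omega : n ≤ 3 * m)
  have h2 : (n : ℝ) ≤ 2 * (n - m) := by
    have : (2 * m : ℝ) ≤ n := by exact_mod_cast (by omega : 2 * m ≤ n)
    linarith
  have h3 : ((n : ℝ) - m) * s ^ 2 * m ≤ V ^ 2 * (b - a) * (d - c) := by
    calc ((n : ℝ) - m) * s ^ 2 * m ≤ V ^ 2 * ((b - a) / m) * (d - c) * m := by gcongr
      _ = V ^ 2 * (b - a) * (d - c) := by field_simp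
  calc s ^ 2 * (n : ℝ) ^ 2 = s ^ 2 * (n * n) := by ring
    _ ≤ s ^ 2 * (2 * (n - m) * (3 * m)) := by
        have : 0 ≤ 2 * ((n : ℝ) - m) := n.cast_nonneg.trans h2
        gcongr
    _ = 6 * (((n : ℝ) - m) * s ^ 2 * m) := by ring
    _ ≤ _ := by gcongr

/-- The default `sSup = 0` covers the empty and unbounded cases; otherwise `0` lies in the set
because singular values are positive. -/
theorem singularValue_nonneg (a b c d : ℝ) (K : ℝ → ℝ → ℝ) (n : ℕ) :
    0 ≤ singularValue a b c d K n := by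
  by_cases hbdd : BddAbove {s : ℝ | ∃ (σ : Fin n → ℝ) (u v : Fin n → ℝ → ℝ),
      IsSingularSystem a b c d K σ u v ∧ ∀ i, s ≤ σ i}
  · rcases eq_empty_or_nonempty {s : ℝ | ∃ (σ : Fin n → ℝ) (u v : Fin n → ℝ → ℝ),
      IsSingularSystem a b c d K σ u v ∧ ∀ i, s ≤ σ i} with hempty | ⟨s, σ, u, v, h, -⟩
    · rw [singularValue, hempty, Real.sSup_empty]
    · exact le_csSup hbdd ⟨σ, u, v, h, fun i => (h.pos i).le⟩
  · rw [singularValue, Real.sSup_of_not_bddAbove hbdd]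

theorem mainTheorem4 (a b c d : ℝ) (hab : a < b) (hcd : c < d) (K : ℝ → ℝ → ℝ)
    (hK : ContinuousOn (fun p : ℝ × ℝ => K p.1 p.2) (Set.Icc a b ×ˢ Set.Icc c d))
    (hV : UniformBoundedVariation a b c d K) :
    (fun n : ℕ => singularValue a b c d K n) =O[Filter.atTop] (fun n : ℕ => ((n : ℝ))⁻¹) := by
  obtain ⟨V, hVx, -⟩ := hV
  set C : ℝ := √(6 * (V ^ 2 * (b - a) * (d - c))) with hC
  refine Asymptotics.IsBigO.of_bound C ?_
  filter_upwards [Filter.eventually_ge_atTop 2] with n hn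
  have hn0 : (0 : ℝ) < n := by exact_mod_cast (by omega : 0 < n)
  rw [Real.norm_of_nonneg (singularValue_nonneg a b c d K n),
    Real.norm_of_nonneg (inv_nonneg.2 hn0.le), ← div_eq_mul_inv]
  have hC0 : 0 ≤ C / n := div_nonneg (Real.sqrt_nonneg _) hn0.le
  refine Real.sSup_le ?_ hC0
  rintro s ⟨σ, u, v, h, hσ⟩
  rcases le_total s 0 with hs | hs
  · exact hs.trans hC0
  · rw [le_div_iff₀ hn0]
    refine Real.le_sqrt_of_sq_le ?_
    rw [mul_pow]
    exact h.sq_mul_sq_le hab hcd hK hVx hn hs hσ
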